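/- Let $G=(V,E)$ be a finite connected simple graph with $n=|V|$ nodes and maximum degree $\Delta$, let $A\subsetneq V$ and let $i\in A$. The unit-potential Metropolis–Hastings walk on $G$ is the Markov chain $X_0,X_1,X_2,\dots$ on $V$ in which the next state after $v$ is chosen with probability proportional to the weight $w(v,u)$, where $$w(v,u)=\min\Big\{\frac1{\deg(v)},\frac1{\deg(u)}\Big\}\ \text{ for } \{v,u\}\in E,\qquad w(v,v)=1-\sum_{u:\{v,u\}\in E}w(v,u),$$ and $w(v,u)=0$ for all other pairs. Let $\mathbb E_i$ denote expectation for the walk started from $X_0=i$, let $T_{V\setminus A}$ be the first time $t>0$ with $X_t\in V\setminus A$, and let $N_i(t)$ be the number of integers $\tau\in[0,t)$ with $X_\tau=i$. Then: (i) $\mathbb E_i\,T_{V\setminus A}<(|A|+1)(6|A|+2\Delta)$; (ii) for every real $t$ with $0<t<6n^2$, $\ \mathbb E_i\,N_i(t)<5\sqrt t+2\Delta$. -/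

import Mathlib

open MeasureTheory ProbabilityTheory
open scoped ENNReal

/-- The weights `w_f` of the Metropolis-Hastings walk on the simple graph `G` with potential
function `f`: an edge `{v, u}` has weight `min (f v / deg v) (f u / deg u)`, the self-loop at `v`
has weight `f v` minus the weights of the edges at `v`, and all other pairs have weight `0`
(they are not arcs). -/
noncomputable def mhWeight {V : Type*} [Fintype V] [DecidableEq V]
    (G : SimpleGraph V) [DecidableRel G.Adj] (f : V → ℝ) (v u : V) : ℝ :=
  if u = v then
    f v - ∑ x ∈ G.neighborFinset v, min (f v / (G.degree v : ℝ)) (f x / (G.degree x : ℝ))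
  else if G.Adj v u then min (f v / (G.degree v : ℝ)) (f u / (G.degree u : ℝ))
  else 0

/-- One-step transition probabilities of the weighted random walk with arc weights `w`: from `v`
the next state `u` is chosen with probability proportional to `w v u`. -/
noncomputable def transitionProb {V : Type*} [Fintype V] (w : V → V → ℝ) (v u : V) : ℝ :=
  w v u / ∑ x, w v x

/-- The process `X`, on the probability space `(Ω, μ)`, is the random walk with arc weights `w`
started from the node `i`: the (time-homogeneous, discrete-time) Markov chain with
transition probabilities `transitionProb w` and initial state `i`. -/
structure IsRandomWalk {V : Type*} [Fintype V] {Ω : Type*} [MeasurableSpace Ω]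
    (w : V → V → ℝ) (i : V) (μ : Measure Ω) (X : ℕ → Ω → V) : Prop where
  measurableSet_eq : ∀ (n : ℕ) (v : V), MeasurableSet {ω | X n ω = v}
  start : ∀ᵐ ω ∂μ, X 0 ω = i
  step : ∀ (n : ℕ) (x : ℕ → V),
    μ {ω | ∀ k ≤ n + 1, X k ω = x k} =
      μ {ω | ∀ k ≤ n, X k ω = x k} * ENNReal.ofReal (transitionProb w (x n) (x (n + 1)))

/-- `T_S`: the first moment of time `t > 0` at which the process visits `S`
(`⊤` if there is none). -/
noncomputable def firstVisit {V Ω : Type*} (X : ℕ → Ω → V) (S : Set V) (ω : Ω) : ℕ∞ :=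
  hittingAfter X S 1 ω

/-- `N_a(t)`: the number of steps in the time interval `[0, t)` during which the process is
at `a`. -/
noncomputable def visitCount {V Ω : Type*} (X : ℕ → Ω → V) (a : V) (t : ℝ) (ω : Ω) : ℕ∞ :=
  {τ : ℕ | (τ : ℝ) < t ∧ X τ ω = a}.encard

/-- The expectation of a random variable with values in `ℕ∞`. -/
noncomputable def expectation {Ω : Type*} [MeasurableSpace Ω] (μ : Measure Ω) (Y : Ω → ℕ∞) :
    ℝ≥0∞ :=
  ∫⁻ ω, (Y ω : ℝ≥0∞) ∂μ

/-! ### The weights of the unit-potential walk -/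

section Weights

variable {V : Type*} [Fintype V] [DecidableEq V] (G : SimpleGraph V) [DecidableRel G.Adj]

/-! The unit-potential weights form a symmetric stochastic matrix `P`. Let `g v` be the expected
number of visits to `v` before time `m` while the walk stays in a set `S`. By symmetry `g - P g ≤
δ_i` on `S`; truncating at `m` keeps every sum finite and only helps the inequality.

Testing against `u = (g - c)⁺`, where `g ≤ c` off `A`, bounds the energy of `u` by `u i`. Conversely
`u i ^ 2 ≤ R * energy` with `R = 6|A| + 2Δ`, an effective resistance bound from Cauchy–Schwarz along
a geodesic leaving `A` (`sq_le_resistance_mul_energy`). Hence `g i ≤ c + R` (`le_add_resistance`).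

For (i), take `S = A` and `c = 0`. The maximum principle `le_apply_pole` gives `g ≤ R` everywhere,
so the exit time has mean at most `|A| R`. For (ii), take `S = V` and let `A` be the superlevel set
`{g > c}`; since `g` has total mass `m`, `|A| < m / c`, and `c = √(6m)` balances the two terms. -/

lemma mhWeight_one_symm (v u : V) :
    mhWeight G (fun _ => (1 : ℝ)) v u = mhWeight G (fun _ => (1 : ℝ)) u v := by
  by_cases h : u = v
  · subst h; rfl
  · simp only [mhWeight, h, Ne.symm h, if_false, G.adj_comm v u, min_comm]

lemma sum_mhWeight_one (v : V) : ∑ u, mhWeight G (fun _ => (1 : ℝ)) v u = 1 := by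
  have h : ∀ u, mhWeight G (fun _ => (1 : ℝ)) v u =
      (if u = v then 1 - ∑ x ∈ G.neighborFinset v,
        min (1 / (G.degree v : ℝ)) (1 / (G.degree x : ℝ)) else 0) +
      (if G.Adj v u then min (1 / (G.degree v : ℝ)) (1 / (G.degree u : ℝ)) else 0) := by
    intro u
    by_cases h : u = v
    · subst h; simp [mhWeight]
    · simp [mhWeight, h]
  simp only [h, Finset.sum_add_distrib, Finset.sum_ite_eq', Finset.mem_univ, if_true,
    ← Finset.sum_filter, SimpleGraph.neighborFinset_eq_filter, sub_add_cancel]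

lemma mhWeight_one_nonneg (v u : V) : 0 ≤ mhWeight G (fun _ => (1 : ℝ)) v u := by
  unfold mhWeight
  split_ifs
  · have h1 : ∑ x ∈ G.neighborFinset v, min (1 / (G.degree v : ℝ)) (1 / (G.degree x : ℝ))
        ≤ ∑ x ∈ G.neighborFinset v, 1 / (G.degree v : ℝ) :=
      Finset.sum_le_sum fun x _ => min_le_left _ _
    have h2 : ∑ x ∈ G.neighborFinset v, 1 / (G.degree v : ℝ) ≤ 1 := by
      rw [Finset.sum_const, SimpleGraph.card_neighborFinset_eq_degree, nsmul_eq_mul, mul_one_div]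
      exact div_self_le_one _
    linarith
  · positivity
  · exact le_rfl

lemma transitionProb_mhWeight_one (v u : V) :
    transitionProb (mhWeight G (fun _ => (1 : ℝ))) v u = mhWeight G (fun _ => (1 : ℝ)) v u := by
  rw [transitionProb, sum_mhWeight_one, div_one]

variable {G} in
-- As a conductance, an edge has resistance equal to the larger endpoint degree, which degree
-- counting along a path can control.
lemma mhWeight_one_of_adj {v u : V} (h : G.Adj v u) :
    mhWeight G (fun _ => (1 : ℝ)) v u = ((max (G.degree v) (G.degree u) : ℕ) : ℝ)⁻¹ := by
  have hv : 0 < (G.degree v : ℝ) := by exact_mod_cast h.degree_pos_left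
  have hu : 0 < (G.degree u : ℝ) := by exact_mod_cast h.degree_pos_right
  rw [mhWeight, if_neg h.ne', if_pos h, Nat.cast_max]
  rcases le_total (G.degree v : ℝ) (G.degree u) with h | h
  · rw [max_eq_right h, min_eq_right (one_div_le_one_div_of_le hv h), one_div]
  · rw [max_eq_left h, min_eq_left (one_div_le_one_div_of_le hu h), one_div]

end Weights

/-! ### Dirichlet energy -/

/-- The Dirichlet energy of `u` with respect to the weights `w`. -/
noncomputable def dirichletEnergy {V : Type*} [Fintype V] (w : V → V → ℝ) (u : V → ℝ) : ℝ :=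
  (∑ v, ∑ x, w v x * (u v - u x) ^ 2) / 2

section Energy

variable {V : Type*} [Fintype V] {w : V → V → ℝ}

/-- Green's identity for symmetric stochastic weights. -/
lemma sum_mul_sub_eq (hs : ∀ v x, w v x = w x v) (h1 : ∀ v, ∑ x, w v x = 1) (u g : V → ℝ) :
    ∑ v, u v * (g v - ∑ x, w v x * g x) =
      (∑ v, ∑ x, w v x * ((u v - u x) * (g v - g x))) / 2 := by
  have e1 : ∑ v, ∑ x, w v x * (u v * (g v - g x)) = ∑ v, u v * (g v - ∑ x, w v x * g x) := by
    refine Finset.sum_congr rfl fun v _ => ?_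
    calc ∑ x, w v x * (u v * (g v - g x))
        = u v * (g v * ∑ x, w v x - ∑ x, w v x * g x) := by
          rw [Finset.mul_sum, ← Finset.sum_sub_distrib, Finset.mul_sum]
          exact Finset.sum_congr rfl fun x _ => by ring
      _ = _ := by rw [h1, mul_one]
  have e2 : ∑ v, ∑ x, w v x * (u x * (g v - g x)) = -∑ v, ∑ x, w v x * (u v * (g v - g x)) := by
    rw [Finset.sum_comm, ← Finset.sum_neg_distrib]
    refine Finset.sum_congr rfl fun v _ => ?_
    rw [← Finset.sum_neg_distrib]
    exact Finset.sum_congr rfl fun x _ => by rw [hs x v]; ring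
  have e3 : ∑ v, ∑ x, w v x * ((u v - u x) * (g v - g x)) =
      ∑ v, ∑ x, w v x * (u v * (g v - g x)) - ∑ v, ∑ x, w v x * (u x * (g v - g x)) := by
    simp only [← Finset.sum_sub_distrib]
    exact Finset.sum_congr rfl fun v _ => Finset.sum_congr rfl fun x _ => by ring
  rw [e3, e2, ← e1]; ring

/-- Truncation from below contracts the Dirichlet form. -/
lemma dirichletEnergy_max_le (hs : ∀ v x, w v x = w x v) (h0 : ∀ v x, 0 ≤ w v x)
    (h1 : ∀ v, ∑ x, w v x = 1) (g : V → ℝ) (c : ℝ) :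
    dirichletEnergy w (fun v => max (g v - c) 0) ≤
      ∑ v, max (g v - c) 0 * (g v - ∑ x, w v x * g x) := by
  rw [sum_mul_sub_eq hs h1, dirichletEnergy]
  gcongr with v _ x _
  · exact h0 v x
  -- Pointwise, `(a⁺ - b⁺)² ≤ (a⁺ - b⁺)(a - b)`.
  · rcases le_total (g v - c) 0 with hv | hv <;> rcases le_total (g x - c) 0 with hx | hx <;>
      simp only [hv, hx, max_eq_left, max_eq_right] <;> nlinarith

/-- The increments over pairs along which `d` increases make up at most the whole energy. -/
lemma sum_le_dirichletEnergy (hs : ∀ v x, w v x = w x v) (h0 : ∀ v x, 0 ≤ w v x)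
    (u : V → ℝ) {p : ℕ → V} {k : ℕ} {d : V → ℕ} (hd : ∀ j ≤ k, d (p j) = j) :
    ∑ j ∈ Finset.range k, w (p j) (p (j + 1)) * (u (p j) - u (p (j + 1))) ^ 2 ≤
      dirichletEnergy w u := by
  classical
  set F : V × V → ℝ := fun q => w q.1 q.2 * (u q.1 - u q.2) ^ 2 with hF
  have hF0 : ∀ q, 0 ≤ F q := fun q => mul_nonneg (h0 _ _) (sq_nonneg _)
  -- The energy counts each unordered pair twice and halves the total; the increasing pairs carry
  -- one copy, and `d` makes the path's pairs distinct.
  set up : Finset (V × V) := Finset.univ.filter fun q => d q.1 < d q.2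
  set dn : Finset (V × V) := Finset.univ.filter fun q => d q.2 < d q.1
  have hdn : ∑ q ∈ dn, F q = ∑ q ∈ up, F q := by
    refine Finset.sum_bij' (fun q _ => q.swap) (fun q _ => q.swap) ?_ ?_ ?_ ?_ ?_
    · simp [up, dn]
    · simp [up, dn]
    · simp
    · simp
    · intro q _
      simp only [hF, Prod.fst_swap, Prod.snd_swap]
      rw [hs]; ring
  have hsum : ∑ q ∈ up, F q + ∑ q ∈ dn, F q ≤ 2 * dirichletEnergy w u := by
    rw [← Finset.sum_union (by
      rw [Finset.disjoint_left]; intro q h1 h2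
      simp only [up, dn, Finset.mem_filter] at h1 h2; omega)]
    refine (Finset.sum_le_sum_of_subset_of_nonneg (Finset.subset_univ _)
      fun q _ _ => hF0 q).trans_eq ?_
    rw [dirichletEnergy, Fintype.sum_prod_type]; ring
  have hpath : ∑ j ∈ Finset.range k, F (p j, p (j + 1)) ≤ ∑ q ∈ up, F q := by
    rw [← Finset.sum_image (g := fun j => (p j, p (j + 1))) (f := F)]
    · refine Finset.sum_le_sum_of_subset_of_nonneg ?_ fun q _ _ => hF0 q
      intro q hq
      obtain ⟨j, hj, rfl⟩ := Finset.mem_image.1 hq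
      rw [Finset.mem_range] at hj
      simp only [up, Finset.mem_filter, Finset.mem_univ, true_and]
      rw [hd j hj.le, hd (j + 1) hj]; omega
    · intro a ha b hb hab
      simp only [Finset.coe_range, Set.mem_Iio] at ha hb
      have := congrArg d (Prod.mk.inj hab).1
      rwa [hd a ha.le, hd b hb.le] at this
  linarith

end Energy

/-! ### Effective resistance -/

section Resistance

variable {V : Type*} [Fintype V] {G : SimpleGraph V}

/-- A shortest path from `v` to the complement of `A`. -/
lemma exists_geodesic_to_compl (hG : G.Connected) {A : Finset V} (hA : A ⊂ Finset.univ) (v : V)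
    (hv : v ∈ A) : ∃ (k : ℕ) (p : ℕ → V), 0 < k ∧ p 0 = v ∧ p k ∉ A ∧
      (∀ j < k, G.Adj (p j) (p (j + 1))) ∧ (∀ j ≤ k, G.dist v (p j) = j) ∧
      ∀ x, G.dist v x < k → x ∈ A := by
  classical
  obtain ⟨b₀, -, hb₀⟩ := Finset.exists_of_ssubset hA
  obtain ⟨b, hb, hmin⟩ := Finset.exists_min_image (Finset.univ.filter (· ∉ A)) (G.dist v)
    ⟨b₀, by simpa using hb₀⟩
  simp only [Finset.mem_filter, Finset.mem_univ, true_and] at hb hmin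
  obtain ⟨q, hq⟩ := hG.exists_walk_length_eq_dist v b
  refine ⟨G.dist v b, q.getVert, ?_, q.getVert_zero, ?_, ?_, ?_, ?_⟩
  · refine hG.pos_dist_of_ne ?_
    rintro rfl
    exact hb hv
  · rwa [← hq, q.getVert_length]
  · intro j hj
    exact q.adj_getVert_succ (hq ▸ hj)
  · intro j hj
    -- The two pieces of the walk bound the two distances by `j` and `dist v b - j`; the triangle
    -- inequality forces equality.
    have h1 := G.dist_le (q.take j)
    have h2 := G.dist_le (q.drop j)
    have h3 : G.dist v b ≤ G.dist v (q.getVert j) + G.dist (q.getVert j) b :=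
      hG.dist_triangle
    rw [SimpleGraph.Walk.take_length] at h1
    rw [SimpleGraph.Walk.drop_length] at h2
    omega
  · intro x hx
    by_contra h
    exact absurd (hmin x h) (by omega)

variable [DecidableRel G.Adj]

/-- A vertex has at most three neighbors on a geodesic. -/
lemma sum_degree_geodesic_le (hG : G.Connected) {A : Finset V} {v : V} {p : ℕ → V} {r : ℕ}
    (hd : ∀ j < r, G.dist v (p j) = j) (hball : ∀ x, G.dist v x ≤ r → x ∈ A) :
    ∑ j ∈ Finset.range r, G.degree (p j) ≤ 3 * A.card := by
  classical
  have hdeg : ∀ j ∈ Finset.range r,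
      G.degree (p j) = ∑ a ∈ A, if G.Adj (p j) a then 1 else 0 := by
    intro j hj
    rw [Finset.mem_range] at hj
    rw [← Finset.card_filter, ← SimpleGraph.card_neighborFinset_eq_degree]
    congr 1
    ext a
    simp only [SimpleGraph.mem_neighborFinset, Finset.mem_filter, iff_and_self]
    intro h
    have h1 : G.dist v a ≤ G.dist v (p j) + G.dist (p j) a := hG.dist_triangle
    rw [SimpleGraph.dist_eq_one_iff_adj.2 h, hd j hj] at h1
    exact hball a (by omega)
  rw [Finset.sum_congr rfl hdeg, Finset.sum_comm, mul_comm, ← smul_eq_mul]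
  refine Finset.sum_le_card_nsmul _ _ _ fun a _ => ?_
  rw [← Finset.card_filter]
  have hsub : (Finset.range r).filter (fun j => G.Adj (p j) a) ⊆
      Finset.Icc (G.dist v a - 1) (G.dist v a + 1) := by
    intro j hj
    obtain ⟨hj, h⟩ := Finset.mem_filter.1 hj
    rw [Finset.mem_range] at hj
    have h1 : G.dist v a ≤ G.dist v (p j) + G.dist (p j) a := hG.dist_triangle
    have h2 : G.dist v (p j) ≤ G.dist v a + G.dist a (p j) := hG.dist_triangle
    rw [SimpleGraph.dist_eq_one_iff_adj.2 h, hd j hj] at h1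
    rw [SimpleGraph.dist_eq_one_iff_adj.2 h.symm, hd j hj] at h2
    rw [Finset.mem_Icc]; omega
  refine (Finset.card_le_card hsub).trans ?_
  rw [Nat.card_Icc]; omega

/-- The resistance of a geodesic leaving `A`. -/
lemma sum_max_degree_geodesic_le (hG : G.Connected) {A : Finset V} {v : V} {p : ℕ → V} {k : ℕ}
    (hd : ∀ j ≤ k, G.dist v (p j) = j) (hball : ∀ x, G.dist v x < k → x ∈ A) :
    ∑ j ∈ Finset.range k, max (G.degree (p j)) (G.degree (p (j + 1))) ≤
      6 * A.card + 2 * G.maxDegree := by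
  have hmax : ∀ j, max (G.degree (p j)) (G.degree (p (j + 1))) ≤ G.maxDegree := fun j =>
    max_le (G.degree_le_maxDegree _) (G.degree_le_maxDegree _)
  match k, hd, hball with
  | 0, _, _ => simp
  | 1, _, _ => have := hmax 0; simp only [Finset.sum_range_one]; omega
  -- The first `s + 1` path vertices have all their neighbors in `A`. They control the first `s`
  -- edges, at cost `2 * 3|A|`; the last two edges cost at most `Δ` each.
  | s + 2, hd, hball =>
    have hsum : ∑ j ∈ Finset.range (s + 1), G.degree (p j) ≤ 3 * A.card :=
      sum_degree_geodesic_le hG (fun j hj => hd j (by omega)) fun x hx => hball x (by omega)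
    have h1 : ∑ j ∈ Finset.range s, max (G.degree (p j)) (G.degree (p (j + 1))) ≤
        ∑ j ∈ Finset.range s, G.degree (p j) + ∑ j ∈ Finset.range s, G.degree (p (j + 1)) := by
      rw [← Finset.sum_add_distrib]
      exact Finset.sum_le_sum fun j _ => max_le (Nat.le_add_right _ _) (Nat.le_add_left _ _)
    have h2 := Finset.sum_range_succ (fun j => G.degree (p j)) s
    have h3 := Finset.sum_range_succ' (fun j => G.degree (p j)) s
    have h4 := hmax s
    have h5 := hmax (s + 1)
    rw [Finset.sum_range_succ, Finset.sum_range_succ]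
    omega

variable [DecidableEq V]

/-- The effective resistance between a vertex of `A` and the complement of `A` is at most
`6 |A| + 2 Δ`. -/
lemma sq_le_resistance_mul_energy (hG : G.Connected) {A : Finset V} (hA : A ⊂ Finset.univ)
    {u : V → ℝ} (hu : ∀ x ∉ A, u x = 0) (v : V) :
    u v ^ 2 ≤ (6 * (A.card : ℝ) + 2 * (G.maxDegree : ℝ)) *
      dirichletEnergy (mhWeight G (fun _ => (1 : ℝ))) u := by
  have hE : 0 ≤ dirichletEnergy (mhWeight G (fun _ => (1 : ℝ))) u :=
    div_nonneg (Finset.sum_nonneg fun x _ => Finset.sum_nonneg fun y _ =>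
      mul_nonneg (mhWeight_one_nonneg G x y) (sq_nonneg _)) zero_le_two
  by_cases hv : v ∈ A
  swap
  · rw [hu v hv]
    simpa using mul_nonneg (by positivity) hE
  obtain ⟨k, p, hk, hp0, hpk, hadj, hd, hball⟩ := exists_geodesic_to_compl hG hA v hv
  have htel : u v = ∑ j ∈ Finset.range k, (u (p j) - u (p (j + 1))) := by
    rw [Finset.sum_range_sub', hp0, hu _ hpk, sub_zero]
  have hres : ∑ j ∈ Finset.range k, ((max (G.degree (p j)) (G.degree (p (j + 1))) : ℕ) : ℝ) ≤
      6 * (A.card : ℝ) + 2 * (G.maxDegree : ℝ) := by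
    exact_mod_cast sum_max_degree_geodesic_le hG hd hball
  have hen := sum_le_dirichletEnergy (mhWeight_one_symm G) (mhWeight_one_nonneg G) u hd
  rw [htel]
  -- Cauchy–Schwarz: squared potential drop ≤ total resistance times energy along the path.
  refine (Finset.sum_sq_le_sum_mul_sum_of_sq_le_mul _
    (f := fun j => ((max (G.degree (p j)) (G.degree (p (j + 1))) : ℕ) : ℝ))
    (g := fun j => mhWeight G (fun _ => (1 : ℝ)) (p j) (p (j + 1)) *
      (u (p j) - u (p (j + 1))) ^ 2) ?_ ?_ ?_).trans
    (mul_le_mul hres hen ?_ ?_)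
  · exact fun _ _ => Nat.cast_nonneg _
  · exact fun _ _ => mul_nonneg (mhWeight_one_nonneg G _ _) (sq_nonneg _)
  · intro j hj
    have h := hadj j (Finset.mem_range.1 hj)
    have hpos : ((max (G.degree (p j)) (G.degree (p (j + 1))) : ℕ) : ℝ) ≠ 0 := by
      have := h.degree_pos_left
      exact Nat.cast_ne_zero.2 (by omega)
    rw [mhWeight_one_of_adj h, mul_inv_cancel_left₀ hpos]
  · exact Finset.sum_nonneg fun _ _ => mul_nonneg (mhWeight_one_nonneg G _ _) (sq_nonneg _)
  · positivity

/-- If `g - P g ≤ δ_i` on `A` and `g ≤ c` off `A`, then the excess of `g` over `c` is controlled by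
the effective resistance and the excess at `i`. -/
lemma sq_max_sub_le (hG : G.Connected) {A : Finset V} (hA : A ⊂ Finset.univ) {i : V}
    {g : V → ℝ} {c : ℝ} (hc : ∀ x ∉ A, g x ≤ c)
    (hg : ∀ x ∈ A, g x - ∑ y, mhWeight G (fun _ => (1 : ℝ)) x y * g y ≤ if x = i then 1 else 0)
    (v : V) :
    max (g v - c) 0 ^ 2 ≤
      (6 * (A.card : ℝ) + 2 * (G.maxDegree : ℝ)) * max (g i - c) 0 := by
  have hu : ∀ x ∉ A, max (g x - c) 0 = 0 := fun x hx =>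
    max_eq_right (sub_nonpos.2 (hc x hx))
  refine (sq_le_resistance_mul_energy hG hA hu v).trans
    (mul_le_mul_of_nonneg_left ?_ (by positivity))
  refine (dirichletEnergy_max_le (mhWeight_one_symm G) (mhWeight_one_nonneg G)
    (sum_mhWeight_one G) g c).trans ?_
  calc ∑ v, max (g v - c) 0 * (g v - ∑ x, mhWeight G (fun _ => (1 : ℝ)) v x * g x)
      ≤ ∑ v, max (g v - c) 0 * (if v = i then 1 else 0) := by
        refine Finset.sum_le_sum fun x _ => ?_
        by_cases hx : x ∈ A
        · exact mul_le_mul_of_nonneg_left (hg x hx) (le_max_right _ _)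
        · simp [hu x hx]
    _ = max (g i - c) 0 := by simp

lemma le_add_resistance (hG : G.Connected) {A : Finset V} (hA : A ⊂ Finset.univ) {i : V}
    {g : V → ℝ} {c : ℝ} (hc : ∀ x ∉ A, g x ≤ c)
    (hg : ∀ x ∈ A, g x - ∑ y, mhWeight G (fun _ => (1 : ℝ)) x y * g y ≤ if x = i then 1 else 0) :
    g i ≤ c + (6 * (A.card : ℝ) + 2 * (G.maxDegree : ℝ)) := by
  have h := sq_max_sub_le hG hA hc hg i
  have hR : 0 ≤ 6 * (A.card : ℝ) + 2 * (G.maxDegree : ℝ) := by positivity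
  rcases le_total (g i - c) 0 with h0 | h0
  · linarith
  · rw [max_eq_left h0] at h
    nlinarith

/-- A maximum principle: the Green function of a set is largest at its pole. -/
lemma le_apply_pole (hG : G.Connected) {A : Finset V} (hA : A ⊂ Finset.univ) {i : V}
    {g : V → ℝ} (hc : ∀ x ∉ A, g x ≤ g i)
    (hg : ∀ x ∈ A, g x - ∑ y, mhWeight G (fun _ => (1 : ℝ)) x y * g y ≤ if x = i then 1 else 0)
    (v : V) : g v ≤ g i := by
  -- At level `c = g i` the excess at the pole is zero, so it is zero everywhere.
  have h := sq_max_sub_le hG hA hc hg v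
  rw [sub_self, max_self, mul_zero] at h
  have h' := pow_eq_zero_iff two_ne_zero |>.1 (le_antisymm h (sq_nonneg _))
  linarith [le_max_left (g v - g i) 0]

end Resistance

/-! ### Random walks confined to a set -/

section Walk

variable {V Ω : Type*} [MeasurableSpace Ω]

/-- The probability that the process stays in `S` up to time `n` and is at `v` at time `n`. -/
noncomputable def confinedMass (μ : Measure Ω) (X : ℕ → Ω → V) (S : Finset V) (n : ℕ) (v : V) :
    ℝ :=
  μ.real {ω | (∀ k ≤ n, X k ω ∈ S) ∧ X n ω = v}

/-- The expected number of visits to `v` before time `m` and before leaving `S`. -/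
noncomputable def confinedGreen (μ : Measure Ω) (X : ℕ → Ω → V) (S : Finset V) (m : ℕ) (v : V) :
    ℝ :=
  ∑ n ∈ Finset.range m, confinedMass μ X S n v

lemma confinedMass_eq_zero (μ : Measure Ω) (X : ℕ → Ω → V) (S : Finset V) (n : ℕ) {v : V} (hv : v ∉ S) :
    confinedMass μ X S n v = 0 := by
  have : {ω | (∀ k ≤ n, X k ω ∈ S) ∧ X n ω = v} = ∅ := by
    ext ω
    simp only [Set.mem_ofPred_eq, Set.mem_empty_iff_false, iff_false]
    rintro ⟨h, rfl⟩
    exact hv (h n le_rfl)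
  rw [confinedMass, this, measureReal_empty]

lemma confinedMass_nonneg (μ : Measure Ω) (X : ℕ → Ω → V) (S : Finset V) (n : ℕ) (v : V) :
    0 ≤ confinedMass μ X S n v :=
  measureReal_nonneg

variable [Fintype V] {w : V → V → ℝ} {i : V} {μ : Measure Ω} {X : ℕ → Ω → V}

namespace IsRandomWalk

lemma measurableSet_mem (hX : IsRandomWalk w i μ X) (n : ℕ) (S : Finset V) :
    MeasurableSet {ω | X n ω ∈ S} := by
  have : {ω | X n ω ∈ S} = ⋃ v ∈ S, {ω | X n ω = v} := by ext; simp
  rw [this]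
  exact S.measurableSet_biUnion fun v _ => hX.measurableSet_eq n v

lemma measurableSet_confined (hX : IsRandomWalk w i μ X) (n : ℕ) (S : Finset V) :
    MeasurableSet {ω | ∀ k ≤ n, X k ω ∈ S} := by
  have : {ω | ∀ k ≤ n, X k ω ∈ S} = ⋂ k ≤ n, {ω | X k ω ∈ S} := by ext; simp
  rw [this]
  exact MeasurableSet.iInter fun k => MeasurableSet.iInter fun _ => hX.measurableSet_mem k S

lemma measurableSet_history (hX : IsRandomWalk w i μ X) (n : ℕ) (y : Fin (n + 1) → V) :
    MeasurableSet ((fun ω (k : Fin (n + 1)) => X k ω) ⁻¹' {y}) := by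
  have : (fun ω (k : Fin (n + 1)) => X k ω) ⁻¹' {y} = ⋂ k : Fin (n + 1), {ω | X k ω = y k} := by
    ext; simp [funext_iff]
  rw [this]
  exact MeasurableSet.iInter fun k => hX.measurableSet_eq k (y k)

/-- The Markov property for an event determined by the history up to time `n`. -/
lemma measure_history_step (hX : IsRandomWalk w i μ X) (n : ℕ) (F : Finset (Fin (n + 1) → V))
    (u v : V) (hF : ∀ y ∈ F, y (Fin.last n) = u) :
    μ ((fun ω (k : Fin (n + 1)) => X k ω) ⁻¹' F ∩ {ω | X (n + 1) ω = v}) =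
      μ ((fun ω (k : Fin (n + 1)) => X k ω) ⁻¹' F) * ENNReal.ofReal (transitionProb w u v) := by
  have hm : ∀ y ∈ F, MeasurableSet ((fun ω (k : Fin (n + 1)) => X k ω) ⁻¹' {y}) := fun y _ =>
    hX.measurableSet_history n y
  rw [← Measure.restrict_apply' (hX.measurableSet_eq (n + 1) v),
    ← sum_measure_preimage_singleton F hm, ← sum_measure_preimage_singleton F hm, Finset.sum_mul]
  refine Finset.sum_congr rfl fun y hy => ?_
  rw [Measure.restrict_apply' (hX.measurableSet_eq (n + 1) v)]
  have hs := hX.step n fun k => if h : k < n + 1 then y ⟨k, h⟩ else v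
  have e1 : (fun ω (k : Fin (n + 1)) => X k ω) ⁻¹' {y} =
      {ω | ∀ k ≤ n, X k ω = if h : k < n + 1 then y ⟨k, h⟩ else v} := by
    ext ω
    simp only [Set.mem_preimage, Set.mem_singleton_iff, Set.mem_ofPred_eq, funext_iff]
    constructor
    · intro h k hk
      rw [dif_pos (Nat.lt_succ_of_le hk)]
      exact h ⟨k, _⟩
    · intro h k
      rw [h k (Nat.le_of_lt_succ k.2), dif_pos k.2]
  have e2 : (fun ω (k : Fin (n + 1)) => X k ω) ⁻¹' {y} ∩ {ω | X (n + 1) ω = v} =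
      {ω | ∀ k ≤ n + 1, X k ω = if h : k < n + 1 then y ⟨k, h⟩ else v} := by
    rw [e1]
    ext ω
    simp only [Set.mem_inter_iff, Set.mem_ofPred_eq]
    constructor
    · rintro ⟨h1, h2⟩ k hk
      rcases Nat.lt_or_ge k (n + 1) with hk' | hk'
      · exact h1 k (Nat.le_of_lt_succ hk')
      · obtain rfl : k = n + 1 := le_antisymm hk hk'
        simpa using h2
    · intro h
      exact ⟨fun k hk => h k (hk.trans n.le_succ), by simpa using h (n + 1) le_rfl⟩
  rw [e2, hs, ← e1]
  simp only [lt_add_iff_pos_right, zero_lt_one, dif_pos, lt_irrefl, dif_neg, not_false_iff]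
  rw [← hF y hy]
  rfl

lemma measure_confined_step (hX : IsRandomWalk w i μ X) (S : Finset V) (n : ℕ) (u v : V) :
    μ ({ω | (∀ k ≤ n, X k ω ∈ S) ∧ X n ω = u} ∩ {ω | X (n + 1) ω = v}) =
      μ {ω | (∀ k ≤ n, X k ω ∈ S) ∧ X n ω = u} * ENNReal.ofReal (transitionProb w u v) := by
  classical
  have h := hX.measure_history_step n
    (Finset.univ.filter fun y : Fin (n + 1) → V => (∀ k, y k ∈ S) ∧ y (Fin.last n) = u) u v
    (by simp)
  have e : (fun ω (k : Fin (n + 1)) => X k ω) ⁻¹'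
      (Finset.univ.filter fun y : Fin (n + 1) → V => (∀ k, y k ∈ S) ∧ y (Fin.last n) = u :
        Finset (Fin (n + 1) → V)) = {ω | (∀ k ≤ n, X k ω ∈ S) ∧ X n ω = u} := by
    ext ω
    simp [Fin.forall_iff]
  rwa [e] at h

variable [IsProbabilityMeasure μ]

lemma confinedMass_succ (hX : IsRandomWalk w i μ X) (hw : ∀ u v, 0 ≤ transitionProb w u v)
    (S : Finset V) (n : ℕ) {v : V} (hv : v ∈ S) :
    confinedMass μ X S (n + 1) v =
      ∑ u, transitionProb w u v * confinedMass μ X S n u := by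
  have e : {ω | (∀ k ≤ n + 1, X k ω ∈ S) ∧ X (n + 1) ω = v} =
      {ω | ∀ k ≤ n, X k ω ∈ S} ∩ {ω | X (n + 1) ω = v} := by
    ext ω
    simp only [Set.mem_ofPred_eq, Set.mem_inter_iff]
    constructor
    · exact fun ⟨h1, h2⟩ => ⟨fun k hk => h1 k (hk.trans n.le_succ), h2⟩
    · rintro ⟨h1, h2⟩
      refine ⟨fun k hk => ?_, h2⟩
      rcases Nat.lt_or_ge k (n + 1) with hk' | hk'
      · exact h1 k (Nat.le_of_lt_succ hk')
      · obtain rfl : k = n + 1 := le_antisymm hk hk'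
        rwa [h2]
  set B : Set Ω := {ω | ∀ k ≤ n, X k ω ∈ S} ∩ {ω | X (n + 1) ω = v} with hB
  have hBm : MeasurableSet B :=
    (hX.measurableSet_confined n S).inter (hX.measurableSet_eq (n + 1) v)
  have hsum := sum_measure_preimage_singleton (μ := μ.restrict B) Finset.univ (f := X n)
    fun y _ => hX.measurableSet_eq n y
  rw [Finset.coe_univ, Set.preimage_univ, Measure.restrict_apply_univ] at hsum
  rw [confinedMass, e, measureReal_def, ← hsum, ENNReal.toReal_sum fun _ _ => measure_ne_top _ _]
  refine Finset.sum_congr rfl fun u _ => ?_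
  have e' : X n ⁻¹' {u} ∩ B =
      {ω | (∀ k ≤ n, X k ω ∈ S) ∧ X n ω = u} ∩ {ω | X (n + 1) ω = v} := by
    ext ω
    simp only [hB, Set.mem_inter_iff, Set.mem_preimage, Set.mem_singleton_iff, Set.mem_ofPred_eq]
    tauto
  rw [Measure.restrict_apply' hBm, e', hX.measure_confined_step, ENNReal.toReal_mul,
    ENNReal.toReal_ofReal (hw u v), confinedMass, measureReal_def, mul_comm]

lemma confinedMass_zero_le [DecidableEq V] (hX : IsRandomWalk w i μ X) (S : Finset V) (v : V) :
    confinedMass μ X S 0 v ≤ if v = i then 1 else 0 := by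
  split_ifs with h
  · exact measureReal_le_one
  · refine le_of_eq ?_
    rw [confinedMass, measureReal_def, measure_mono_null (t := {ω | ¬X 0 ω = i}) ?_
      (ae_iff.1 hX.start), ENNReal.toReal_zero]
    rintro ω ⟨-, hω⟩
    simpa [hω] using h

lemma sum_confinedMass (hX : IsRandomWalk w i μ X) (S : Finset V) (n : ℕ) :
    ∑ v, confinedMass μ X S n v = μ.real {ω | ∀ k ≤ n, X k ω ∈ S} := by
  have hBm := hX.measurableSet_confined n S
  have hsum := sum_measure_preimage_singleton (μ := μ.restrict {ω | ∀ k ≤ n, X k ω ∈ S})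
    Finset.univ (f := X n) fun y _ => hX.measurableSet_eq n y
  rw [Finset.coe_univ, Set.preimage_univ, Measure.restrict_apply_univ] at hsum
  rw [measureReal_def, ← hsum, ENNReal.toReal_sum fun _ _ => measure_ne_top _ _]
  refine Finset.sum_congr rfl fun u _ => ?_
  rw [Measure.restrict_apply' hBm, confinedMass, measureReal_def, Set.inter_comm]
  rfl

/-- Mass balance: summing the one-step equation over time telescopes to the mass at time `0` minus
the mass at time `m`. -/
lemma confinedGreen_sub_le [DecidableEq V] (hX : IsRandomWalk w i μ X)
    (hw : ∀ u v, 0 ≤ transitionProb w u v) (S : Finset V) (m : ℕ) {v : V} (hv : v ∈ S) :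
    confinedGreen μ X S m v - ∑ u, transitionProb w u v * confinedGreen μ X S m u ≤
      if v = i then 1 else 0 := by
  have h1 : ∑ n ∈ Finset.range m, confinedMass μ X S (n + 1) v =
      ∑ u, transitionProb w u v * confinedGreen μ X S m u := by
    simp only [confinedGreen, Finset.mul_sum]
    rw [Finset.sum_comm]
    exact Finset.sum_congr rfl fun n _ => hX.confinedMass_succ hw S n hv
  have h2 := Finset.sum_range_succ (fun n => confinedMass μ X S n v) m
  have h3 := Finset.sum_range_succ' (fun n => confinedMass μ X S n v) m
  have h4 := hX.confinedMass_zero_le S v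
  have h5 : 0 ≤ confinedMass μ X S m v := measureReal_nonneg
  rw [← h1, confinedGreen]
  linarith

end IsRandomWalk

/-! ### Expectations of visiting times and counts -/

/-- Tail-sum form of the exit time; if the walk never leaves `A`, the right side is `⊤`. -/
lemma firstVisit_compl_le {V Ω : Type*} {X : ℕ → Ω → V} {A : Finset V} {ω : Ω} (h0 : X 0 ω ∈ A) :
    (firstVisit X ((A : Set V)ᶜ) ω : ℝ≥0∞) ≤
      ∑' n, {ω | ∀ k ≤ n, X k ω ∈ A}.indicator (fun _ => (1 : ℝ≥0∞)) ω := by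
  classical
  by_cases h : ∃ j, X j ω ∉ A
  · have hmin := fun k => Nat.find_min h (m := k)
    have hspec := Nat.find_spec h
    set j := Nat.find h
    have hj : 1 ≤ j := by
      rcases Nat.eq_zero_or_pos j with h | h
      · rw [h] at hspec; exact absurd h0 hspec
      · exact h
    have hT : firstVisit X ((A : Set V)ᶜ) ω ≤ (j : ℕ∞) :=
      hittingAfter_le_of_mem hj (by simpa using hspec)
    calc (firstVisit X ((A : Set V)ᶜ) ω : ℝ≥0∞) ≤ ((j : ℕ∞) : ℝ≥0∞) := by exact_mod_cast hT
      _ = ∑ n ∈ Finset.range j, {ω | ∀ k ≤ n, X k ω ∈ A}.indicator (fun _ => (1 : ℝ≥0∞)) ω := by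
        rw [Finset.sum_congr rfl fun n hn => Set.indicator_of_mem ?_ _]
        · simp
        · intro k hk
          exact not_not.1 (hmin k (hk.trans_lt (Finset.mem_range.1 hn)))
      _ ≤ _ := ENNReal.sum_le_tsum _
  · push Not at h
    have : ∀ n, {ω | ∀ k ≤ n, X k ω ∈ A}.indicator (fun _ => (1 : ℝ≥0∞)) ω = 1 := fun n =>
      Set.indicator_of_mem (show ω ∈ {ω | ∀ k ≤ n, X k ω ∈ A} from fun k _ => h k) _
    simp [this]

lemma IsRandomWalk.expectation_firstVisit_le [IsProbabilityMeasure μ]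
    (hX : IsRandomWalk w i μ X) {A : Finset V} (hi : i ∈ A) {C : ℝ}
    (hC : ∀ m, ∑ v, confinedGreen μ X A m v ≤ C) :
    expectation μ (firstVisit X ((A : Set V)ᶜ)) ≤ ENNReal.ofReal C := by
  have hle : expectation μ (firstVisit X ((A : Set V)ᶜ)) ≤
      ∑' n, μ {ω | ∀ k ≤ n, X k ω ∈ A} := by
    rw [expectation]
    calc ∫⁻ ω, (firstVisit X ((A : Set V)ᶜ) ω : ℝ≥0∞) ∂μ
        ≤ ∫⁻ ω, ∑' n, {ω | ∀ k ≤ n, X k ω ∈ A}.indicator (fun _ => (1 : ℝ≥0∞)) ω ∂μ := by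
          refine lintegral_mono_ae (hX.start.mono fun ω hω => firstVisit_compl_le ?_)
          rwa [hω]
      _ = _ := by
          rw [lintegral_tsum fun n =>
            (measurable_const.indicator (hX.measurableSet_confined n A)).aemeasurable]
          refine tsum_congr fun n => ?_
          rw [lintegral_indicator_const (hX.measurableSet_confined n A), one_mul]
  refine hle.trans ?_
  rw [ENNReal.tsum_eq_iSup_nat]
  refine iSup_le fun m => ?_
  have h : ∑ n ∈ Finset.range m, μ {ω | ∀ k ≤ n, X k ω ∈ A} =
      ENNReal.ofReal (∑ v, confinedGreen μ X A m v) := by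
    simp only [confinedGreen]
    rw [Finset.sum_comm, ENNReal.ofReal_sum_of_nonneg fun n _ =>
      Finset.sum_nonneg fun v _ => confinedMass_nonneg μ X A n v]
    refine Finset.sum_congr rfl fun n _ => ?_
    rw [hX.sum_confinedMass, ofReal_measureReal]
  rw [h]
  exact ENNReal.ofReal_le_ofReal (hC m)

lemma IsRandomWalk.expectation_visitCount [IsProbabilityMeasure μ]
    (hX : IsRandomWalk w i μ X) (a : V) (t : ℝ) :
    expectation μ (visitCount X a t) =
      ENNReal.ofReal (confinedGreen μ X Finset.univ ⌈t⌉₊ a) := by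
  classical
  have hcount : ∀ ω, ((visitCount X a t ω : ℕ∞) : ℝ≥0∞) =
      ∑ n ∈ Finset.range ⌈t⌉₊, {ω | X n ω = a}.indicator (fun _ => (1 : ℝ≥0∞)) ω := by
    intro ω
    have e : {τ : ℕ | (τ : ℝ) < t ∧ X τ ω = a} =
        ((Finset.range ⌈t⌉₊).filter fun n => X n ω = a : Finset ℕ) := by
      ext τ
      simp [Nat.lt_ceil]
    rw [visitCount, e, Set.encard_coe_eq_coe_finsetCard]
    simp [Set.indicator_apply]
  rw [expectation, lintegral_congr hcount, lintegral_finsetSum _ fun n _ =>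
    measurable_const.indicator (hX.measurableSet_eq n a), confinedGreen,
    ENNReal.ofReal_sum_of_nonneg fun n _ => confinedMass_nonneg μ X _ n a]
  refine Finset.sum_congr rfl fun n _ => ?_
  rw [lintegral_indicator_const (hX.measurableSet_eq n a), one_mul, confinedMass,
    ofReal_measureReal]
  simp

end Walk

/-! ### The unit-potential Metropolis-Hastings walk -/

section MetropolisHastings

variable {V : Type*} [Fintype V] [DecidableEq V] {G : SimpleGraph V} [DecidableRel G.Adj]
  {i : V} {Ω : Type*} [MeasurableSpace Ω] {μ : Measure Ω} [IsProbabilityMeasure μ]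
  {X : ℕ → Ω → V}

/-- Symmetry of the weights turns the incoming flow at `v` into the average `P g` at `v`. -/
lemma IsRandomWalk.confinedGreen_sub_mhWeight_le
    (hX : IsRandomWalk (mhWeight G (fun _ => (1 : ℝ))) i μ X) (S : Finset V) (m : ℕ) {v : V}
    (hv : v ∈ S) :
    confinedGreen μ X S m v -
      ∑ u, mhWeight G (fun _ => (1 : ℝ)) v u * confinedGreen μ X S m u ≤
      if v = i then 1 else 0 := by
  have h := hX.confinedGreen_sub_le
    (fun u v => by rw [transitionProb_mhWeight_one]; exact mhWeight_one_nonneg G u v) S m hv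
  simpa only [transitionProb_mhWeight_one, mhWeight_one_symm G _ v] using h

lemma IsRandomWalk.sum_confinedGreen_le (hG : G.Connected) {A : Finset V}
    (hA : A ⊂ Finset.univ) (hX : IsRandomWalk (mhWeight G (fun _ => (1 : ℝ))) i μ X) (m : ℕ) :
    ∑ v, confinedGreen μ X A m v ≤
      A.card * (6 * (A.card : ℝ) + 2 * (G.maxDegree : ℝ)) := by
  have h0 : ∀ x ∉ A, confinedGreen μ X A m x = 0 := fun x hx =>
    Finset.sum_eq_zero fun n _ => confinedMass_eq_zero μ X A n hx
  have hi : 0 ≤ confinedGreen μ X A m i :=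
    Finset.sum_nonneg fun n _ => confinedMass_nonneg μ X A n i
  have hsub := fun x (hx : x ∈ A) => hX.confinedGreen_sub_mhWeight_le A m hx
  have hR := le_add_resistance hG hA (fun x hx => (h0 x hx).le) hsub
  have hmax := le_apply_pole hG hA (fun x hx => (h0 x hx).trans_le hi) hsub
  rw [zero_add] at hR
  rw [← Finset.sum_subset A.subset_univ fun x _ hx => h0 x hx, ← nsmul_eq_mul]
  exact Finset.sum_le_card_nsmul _ _ _ fun v _ => (hmax v).trans hR

lemma IsRandomWalk.confinedGreen_univ_le (hG : G.Connected)
    (hX : IsRandomWalk (mhWeight G (fun _ => (1 : ℝ))) i μ X) {m : ℕ} (hm : 0 < m)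
    (hmn : m ≤ 6 * Fintype.card V ^ 2) :
    confinedGreen μ X Finset.univ m i ≤ 2 * √(6 * m) + 2 * (G.maxDegree : ℝ) := by
  set g := confinedGreen μ X Finset.univ m with hg
  set c : ℝ := √(6 * m) with hc
  have hm' : (0 : ℝ) < m := by exact_mod_cast hm
  have hcpos : 0 < c := Real.sqrt_pos.2 (by positivity)
  have hcsq : c ^ 2 = 6 * m := Real.sq_sqrt (by positivity)
  have hgnn : ∀ v, 0 ≤ g v := fun v =>
    Finset.sum_nonneg fun n _ => confinedMass_nonneg μ X Finset.univ n v
  have hgsum : ∑ v, g v = m := by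
    simp only [hg, confinedGreen]
    rw [Finset.sum_comm]
    simp [hX.sum_confinedMass]
  set A : Finset V := Finset.univ.filter fun v => c < g v with hAdef
  by_cases hi : i ∈ A
  swap
  · have : g i ≤ c := by simpa [hAdef] using hi
    have : (0 : ℝ) ≤ G.maxDegree := Nat.cast_nonneg _
    linarith
  have hcard : A.card * c < m := by
    calc A.card * c = ∑ v ∈ A, c := by rw [Finset.sum_const, nsmul_eq_mul]
      _ < ∑ v ∈ A, g v :=
        Finset.sum_lt_sum_of_nonempty ⟨i, hi⟩ fun v hv => (Finset.mem_filter.1 hv).2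
      _ ≤ ∑ v, g v := Finset.sum_le_sum_of_subset_of_nonneg A.subset_univ fun v _ _ => hgnn v
      _ = m := hgsum
  -- From `|A| c < m` and `c² = 6m`.
  have hcard' : 6 * (A.card : ℝ) < c := by
    refine lt_of_mul_lt_mul_right ?_ hcpos.le
    nlinarith
  -- If `A = V`, then `6n < c` gives `36n² < 6m`, contradicting `m ≤ 6n²`; this is where the range
  -- of `t` enters.
  have hA : A ⊂ Finset.univ := by
    refine Finset.ssubset_univ_iff.2 fun hAu => ?_
    rw [hAu, Finset.card_univ] at hcard'
    have : (m : ℝ) ≤ 6 * (Fintype.card V : ℝ) ^ 2 := by exact_mod_cast hmn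
    have h0 : (0 : ℝ) ≤ Fintype.card V := Nat.cast_nonneg _
    nlinarith
  have h := le_add_resistance hG hA (c := c) (g := g)
    (fun x hx => by simpa [hAdef] using hx)
    fun x _ => hX.confinedGreen_sub_mhWeight_le Finset.univ m (Finset.mem_univ x)
  linarith

lemma IsRandomWalk.confinedGreen_univ_ceil_lt (hG : G.Connected) (hΔ : 0 < G.maxDegree)
    (hX : IsRandomWalk (mhWeight G (fun _ => (1 : ℝ))) i μ X) {t : ℝ} (ht : 0 < t)
    (htn : t < 6 * (Fintype.card V : ℝ) ^ 2) :
    confinedGreen μ X Finset.univ ⌈t⌉₊ i < 5 * √t + 2 * (G.maxDegree : ℝ) := by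
  have hΔ' : (1 : ℝ) ≤ G.maxDegree := by exact_mod_cast hΔ
  have hlt := Nat.ceil_lt_add_one ht.le
  have hmpos : 0 < ⌈t⌉₊ := Nat.ceil_pos.2 ht
  have hmn : ⌈t⌉₊ ≤ 6 * Fintype.card V ^ 2 := by
    rw [Nat.ceil_le]; push_cast; exact htn.le
  set m := ⌈t⌉₊
  have hs := Real.sq_sqrt ht.le
  have hs0 := Real.sqrt_pos.2 ht
  -- For `t ≤ 25`, the trivial bound `⌈t⌉ < t + 1 ≤ 5√t + 1` suffices. For `t ≥ 25`, `24⌈t⌉ < 24(t +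
  -- 1) < 25t` absorbs the rounding.
  rcases le_total t 25 with h25 | h25
  · have htriv : confinedGreen μ X Finset.univ m i ≤ m := by
      calc confinedGreen μ X Finset.univ m i ≤ ∑ _n ∈ Finset.range m, (1 : ℝ) :=
            Finset.sum_le_sum fun n _ => measureReal_le_one
        _ = m := by simp
    have : √t ≤ 5 := Real.sqrt_le_iff.2 ⟨by norm_num, by linarith⟩
    nlinarith
  · have h := hX.confinedGreen_univ_le hG hmpos hmn
    have h2 : 2 * √(6 * m) < 5 * √t := by
      have h6 := Real.sq_sqrt (show (0 : ℝ) ≤ 6 * m by positivity)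
      refine lt_of_pow_lt_pow_left₀ 2 (by positivity) ?_
      rw [mul_pow, mul_pow, h6, hs]
      linarith
    linarith

end MetropolisHastings

theorem lemma2 {V : Type*} [Fintype V] [DecidableEq V] (G : SimpleGraph V) [DecidableRel G.Adj]
    (hG : G.Connected) (A : Finset V) (hA : A ⊂ Finset.univ) (i : V) (hi : i ∈ A)
    {Ω : Type*} [MeasurableSpace Ω] (μ : Measure Ω) [IsProbabilityMeasure μ]
    (X : ℕ → Ω → V) (hX : IsRandomWalk (mhWeight G (fun _ => (1 : ℝ))) i μ X) :
    expectation μ (firstVisit X ((A : Set V)ᶜ)) <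
        ((A.card : ℝ≥0∞) + 1) * (6 * (A.card : ℝ≥0∞) + 2 * (G.maxDegree : ℝ≥0∞)) ∧
      ∀ t : ℝ, 0 < t → t < 6 * (Fintype.card V : ℝ) ^ 2 →
        expectation μ (visitCount X i t) <
          ENNReal.ofReal (5 * Real.sqrt t + 2 * (G.maxDegree : ℝ)) := by
  obtain ⟨b, -, hb⟩ := Finset.exists_of_ssubset hA
  -- At least two vertices and connectedness give `Δ > 0`, needed for both strict inequalities.
  have : Nontrivial V := ⟨i, b, fun h => hb (h ▸ hi)⟩
  have hΔ : 0 < G.maxDegree := (hG.preconnected.degree_pos_of_nontrivial i).trans_le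
    (G.degree_le_maxDegree i)
  refine ⟨?_, fun t ht htn => ?_⟩
  · refine (hX.expectation_firstVisit_le hi (hX.sum_confinedGreen_le hG hA)).trans_lt ?_
    have e : ((A.card : ℝ≥0∞) + 1) * (6 * (A.card : ℝ≥0∞) + 2 * (G.maxDegree : ℝ≥0∞)) =
        ENNReal.ofReal ((A.card + 1) * (6 * (A.card : ℝ) + 2 * (G.maxDegree : ℝ))) := by
      have : ((A.card + 1) * (6 * (A.card : ℝ) + 2 * (G.maxDegree : ℝ))) =
          (((A.card + 1) * (6 * A.card + 2 * G.maxDegree) : ℕ) : ℝ) := by push_cast; ring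
      rw [this, ENNReal.ofReal_natCast]
      push_cast; ring
    have hΔ' : (0 : ℝ) < G.maxDegree := by exact_mod_cast hΔ
    rw [e, ENNReal.ofReal_lt_ofReal_iff (by positivity)]
    have : 0 < 6 * (A.card : ℝ) + 2 * (G.maxDegree : ℝ) := by positivity
    linarith
  · rw [hX.expectation_visitCount, ENNReal.ofReal_lt_ofReal_iff (by positivity)]
    exact hX.confinedGreen_univ_ceil_lt hG hΔ ht htn
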